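/- Throughout, $\Gamma$ is a finite abelian group, written additively. A graph $G=(V,E)$ with $|E|=|\Gamma|$ is called *$\Gamma$-harmonious* if there is an injection $f:V\to\Gamma$ (a *$\Gamma$-harmonious labeling*) such that the induced edge labels $w(xy)=f(x)+f(y)$, $xy\in E$, are pairwise distinct; equivalently, $w:E\to\Gamma$ is a bijection. The *generalized prism* $Y_{m,n}=P_m\,\Box\,C_n$ is the Cartesian product of the path $P_m$ on $m$ vertices and the cycle $C_n$ on $n$ vertices. The *generalized closed web* $CW_{m,n}$ arises from $Y_{m,n}$ by adding one new vertex and joining it by an edge to every vertex of the top cycle, i.e. of the copy of $C_n$ at one end vertex of $P_m$; it has $2mn$ edges. **Theorem.** Let $n\ge 3$ and $m\ge 2$ be integers and let $\Gamma$ be an abelian group of order $2mn$. Suppose that $\Gamma$ has a subgroup $H$ of order $n$ such that the quotient group $\Gamma/H$ is cyclic and such that either 1. $n$ is odd, or 2. $n$ is even and $H$ has a subgroup isomorphic to $\mathbb{Z}_2\oplus\mathbb{Z}_{2s}$ for some integer $s\ge 2$. Then the generalized closed web $CW_{m,n}$ is $\Gamma$-harmonious, that is, it admits a $\Gamma$-harmonious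 labeling. -/

import Mathlib

/-- The label `f x + f y` that a vertex labeling `f` induces on the unordered pair `s(x, y)`. -/
def edgeLabel {V Γ : Type*} [AddCommGroup Γ] (f : V → Γ) : Sym2 V → Γ :=
  Sym2.lift ⟨fun x y => f x + f y, fun x y => add_comm (f x) (f y)⟩

/-- `f` is a `Γ`-harmonious labeling of `G`: it is injective on the vertices, and the induced
labels `f x + f y` of the edges are pairwise distinct and exhaust `Γ` (so that, in particular,
the number of edges of `G` is the order of `Γ`). -/
def IsHarmoniousLabeling {V Γ : Type*} [AddCommGroup Γ] (G : SimpleGraph V) (f : V → Γ) : Prop :=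
  Function.Injective f ∧ Set.BijOn (edgeLabel f) G.edgeSet Set.univ

/-- The graph `G` is `Γ`-harmonious. -/
def IsHarmonious {V : Type*} (Γ : Type*) [AddCommGroup Γ] (G : SimpleGraph V) : Prop :=
  ∃ f : V → Γ, IsHarmoniousLabeling G f

/-- The generalized prism `Y_{m,n}`: the Cartesian product of the path `P_m` on `m` vertices and
the cycle `C_n`. The vertices `(j, i)` with `j` fixed form the `j`-th copy of `C_n`. -/
def generalizedPrism (m n : ℕ) : SimpleGraph (Fin m × Fin n) :=
  (SimpleGraph.pathGraph m).boxProd (SimpleGraph.cycleGraph n)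

/-- The generalized closed web `CW_{m,n}`: the generalized prism `Y_{m,n}` (vertices `some (j, i)`)
together with a new vertex `none`, joined to every vertex `some (0, i)` of the top cycle. -/
def generalizedClosedWeb (m n : ℕ) : SimpleGraph (Option (Fin m × Fin n)) where
  Adj
    | none, none => False
    | none, some y => y.1.val = 0
    | some x, none => x.1.val = 0
    | some x, some y => (generalizedPrism m n).Adj x y
  symm := ⟨by
    rintro (_ | x) (_ | y) h
    · exact h
    · exact h
    · exact h
    · exact SimpleGraph.Adj.symm h⟩
  loopless := ⟨by
    rintro (_ | x) h
    · exact h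
    · exact (generalizedPrism m n).irrefl h⟩

/-- The group `A` has order `n`, and either `n` is odd, or `n` is even and `A` has a subgroup
isomorphic to `Z_2 ⊕ Z_{2s}` for some `s ≥ 2`. -/
def SatisfiesCycleCondition (n : ℕ) (A : Type*) [AddCommGroup A] : Prop :=
  Nat.card A = n ∧
    (Odd n ∨
      (Even n ∧ ∃ s : ℕ, 2 ≤ s ∧ ∃ K : AddSubgroup A, Nonempty (K ≃+ ZMod 2 × ZMod (2 * s))))

/-!
List `H` cyclically as `a₀, a₁, …` so that the sums `aᵢ + aᵢ₊₁` of neighbours again run over all of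
`H`, and let `g` generate `Γ` modulo `H`. Label the apex by `0` and the `i`-th vertex of the `j`-th
cycle by `(j + 1) • g + aᵢ₊ⱼ`. The edges of the `j`-th cycle then fill the coset of `(2j + 2) • g`
and the edges leading from it towards the apex that of `(2j + 1) • g`, so every coset is hit once.

Cyclic listings lift along surjections `A → B`. If the kernel has odd order, go around `B` once for
every kernel element. If the kernel has exponent two and order at least four, go up and down `B`
along strands, one for every kernel element and at most eight at a time, where the kernel parts of
the strands are permuted from level to level so that no sum repeats. Odd groups reduce in this way
to cyclic ones. Otherwise `H` has more than two elements killed by doubling. Either doubling maps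
`H` onto an odd group, or splitting off the odd part leaves a non-cyclic product of groups `ℤ/2^e`;
in such a product, lowering two exponents at a time leads down to `ℤ/2 × ℤ/4h`, `ℤ/4 × ℤ/4` or
`ℤ/2 × ℤ/2 × ℤ/4`, for which listings are written down.
-/

/-! ### Cyclic listings -/

/-- `A` is finite and its elements can be listed along a cycle so that the sums of consecutive
elements are pairwise distinct. Indices are taken modulo `n`, so `k + 1` wraps around. -/
def IsCyclicallyHarmonious (A : Type*) [AddCommGroup A] : Prop :=
  ∃ (n : ℕ) (_ : NeZero n) (a : Fin n ≃ A), Function.Injective fun k => a k + a (k + 1)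

/-- The successor of a cell in an `N × n` grid that is read row by row, returning to the first
cell after the last one. -/
def nextCell {N n : ℕ} [NeZero N] [NeZero n] (x : Fin N × Fin n) : Fin N × Fin n :=
  (if x.2 + 1 = 0 then x.1 + 1 else x.1, x.2 + 1)

theorem val_add_one_eq_ite {n : ℕ} [NeZero n] (k : Fin n) :
    (k + 1).val = if k.val + 1 = n then 0 else k.val + 1 := by
  rw [Fin.val_add, Fin.val_one', Nat.add_mod_mod]
  split_ifs with h
  · rw [h, Nat.mod_self]
  · exact Nat.mod_eq_of_lt (by omega)

theorem finProdFinEquiv_nextCell {N n : ℕ} [NeZero N] [NeZero n] [NeZero (N * n)]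
    (x : Fin N × Fin n) : finProdFinEquiv (nextCell x) = finProdFinEquiv x + 1 := by
  obtain ⟨j, i⟩ := x
  ext
  simp only [nextCell, finProdFinEquiv_apply_val, val_add_one_eq_ite, Fin.ext_iff, Fin.val_zero]
  by_cases hi : i.val + 1 = n
  · have hrow : i.val + n * j.val + 1 = (j.val + 1) * n := by rw [add_mul, mul_comm n]; omega
    simp only [hi, hrow, Nat.mul_left_inj (NeZero.ne n), if_true, val_add_one_eq_ite, zero_add]
    split_ifs <;> ring
  · have hrow : i.val + n * j.val + 1 < N * n :=
      calc i.val + n * j.val + 1 < n * (j.val + 1) := by rw [mul_add]; omega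
        _ ≤ N * n := mul_comm n N ▸ Nat.mul_le_mul_left n j.isLt
    simp only [hi, hrow.ne, if_false, Nat.succ_ne_zero]
    ring

namespace IsCyclicallyHarmonious

variable {A B : Type*} [AddCommGroup A] [AddCommGroup B]

theorem finite (hA : IsCyclicallyHarmonious A) : Finite A := by
  obtain ⟨n, _, a, -⟩ := hA
  exact Finite.of_equiv _ a

theorem of_injective {n : ℕ} [NeZero n] (hn : Nat.card A = n) (a : Fin n → A)
    (ha : Function.Injective a) (hsum : Function.Injective fun k => a k + a (k + 1)) :
    IsCyclicallyHarmonious A := by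
  have : Finite A := Nat.finite_of_card_ne_zero (hn ▸ NeZero.ne n)
  have hbij := (Nat.bijective_iff_injective_and_card a).mpr ⟨ha, by simp [hn]⟩
  exact ⟨n, inferInstance, Equiv.ofBijective a hbij, hsum⟩

theorem of_addEquiv (e : B ≃+ A) (hB : IsCyclicallyHarmonious B) : IsCyclicallyHarmonious A := by
  obtain ⟨n, hn, b, hb⟩ := hB
  refine ⟨n, hn, b.trans e.toEquiv, fun k l hkl => hb (e.injective ?_)⟩
  simpa using hkl

theorem of_grid {N n : ℕ} [NeZero N] [NeZero n] (hcard : Nat.card A = N * n)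
    (E : Fin N × Fin n → A) (hE : Function.Injective E)
    (hsum : Function.Injective fun x => E x + E (nextCell x)) : IsCyclicallyHarmonious A := by
  have : NeZero (N * n) := ⟨mul_ne_zero (NeZero.ne N) (NeZero.ne n)⟩
  have hsymm (k : Fin (N * n)) :
      finProdFinEquiv.symm (k + 1) = nextCell (finProdFinEquiv.symm k) := by
    rw [Equiv.symm_apply_eq, finProdFinEquiv_nextCell, Equiv.apply_symm_apply]
  refine of_injective hcard (E ∘ finProdFinEquiv.symm)
    (hE.comp finProdFinEquiv.symm.injective) ?_
  simp only [Function.comp_apply, hsymm]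
  exact hsum.comp finProdFinEquiv.symm.injective

end IsCyclicallyHarmonious

/-! ### Kernels of odd order -/

theorem injective_add_self_of_odd_card {A : Type*} [AddCommGroup A] (hA : Odd (Nat.card A)) :
    Function.Injective fun x : A => x + x := by
  simpa only [two_nsmul] using (Nat.Coprime.nsmul_right_bijective hA.coprime_two_right).injective

theorem card_ker_mul_card_of_surjective {A B : Type*} [AddCommGroup A] [AddCommGroup B]
    {π : A →+ B} (hπ : Function.Surjective π) : Nat.card π.ker * Nat.card B = Nat.card A := by
  rw [← Nat.card_congr (QuotientAddGroup.quotientKerEquivOfSurjective π hπ).toEquiv, mul_comm,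
    ← π.ker.card_eq_card_quotient_mul_card_addSubgroup]

namespace IsCyclicallyHarmonious

variable {A B : Type*} [AddCommGroup A] [AddCommGroup B]

theorem of_odd_ker {π : A →+ B} (hπ : Function.Surjective π) (hodd : Odd (Nat.card π.ker))
    (hker : IsCyclicallyHarmonious π.ker) (hB : IsCyclicallyHarmonious B) :
    IsCyclicallyHarmonious A := by
  obtain ⟨N, _, b, hb⟩ := hker
  obtain ⟨n, _, a, ha⟩ := hB
  have hcard : Nat.card A = N * n := by
    rw [← card_ker_mul_card_of_surjective hπ, ← Nat.card_congr b, ← Nat.card_congr a,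
      Nat.card_fin, Nat.card_fin]
  set ℓ := Function.surjInv hπ
  have hℓ (x : B) : π (ℓ x) = x := Function.surjInv_eq hπ x
  have hπb (j : Fin N) : π (b j) = 0 := (b j).2
  refine of_grid hcard (fun x => ℓ (a x.2) + b x.1) ?_ ?_
  · rintro ⟨j, i⟩ ⟨j', i'⟩ h
    have hi : i = i' := a.injective (by simpa [hℓ, hπb] using congrArg π h)
    subst hi
    simpa using h
  · rintro ⟨j, i⟩ ⟨j', i'⟩ h
    have hi : i = i' := ha (by simpa [nextCell, hℓ, hπb] using congrArg π h)
    subst hi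
    simp only [nextCell] at h
    rw [add_add_add_comm, add_add_add_comm (ℓ (a i)) (b j' : A), add_right_inj] at h
    split_ifs at h with hlast
    · simpa using hb (Subtype.ext h)
    · simpa using injective_add_self_of_odd_card hodd (Subtype.ext h)

theorem of_isAddCyclic_of_odd_card [IsAddCyclic A] (hA : Odd (Nat.card A)) :
    IsCyclicallyHarmonious A := by
  have : NeZero (Nat.card A) := ⟨hA.pos.ne'⟩
  let e : Fin (Nat.card A) ≃+ A :=
    (ZMod.finEquiv (Nat.card A)).toAddEquiv.trans (zmodAddCyclicAddEquiv ‹_›)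
  refine of_injective rfl e e.injective fun k l hkl => e.injective ?_
  exact injective_add_self_of_odd_card hA (by simpa [← add_assoc] using hkl)

theorem of_odd_card (hA : Odd (Nat.card A)) : IsCyclicallyHarmonious A := by
  induction hc : Nat.card A using Nat.strong_induction_on generalizing A with
  | _ c ih =>
    have : Finite A := Nat.finite_of_card_ne_zero hA.pos.ne'
    cases subsingleton_or_nontrivial A
    · exact of_isAddCyclic_of_odd_card hA
    obtain ⟨x, hx⟩ := exists_ne (0 : A)
    set L := AddSubgroup.zmultiples x
    have hcard := L.card_eq_card_quotient_mul_card_addSubgroup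
    have hL : Odd (Nat.card L) := hA.of_dvd_nat L.card_addSubgroup_dvd_card
    have hker : (QuotientAddGroup.mk' L).ker = L := QuotientAddGroup.ker_mk' L
    refine of_odd_ker (QuotientAddGroup.mk'_surjective L) (hker.symm ▸ hL)
      (hker.symm ▸ of_isAddCyclic_of_odd_card hL)
      (ih _ ?_ (hA.of_dvd_nat (Dvd.intro _ hcard.symm)) rfl)
    have hL1 : 1 < Nat.card L := by
      have : Nontrivial L :=
        L.nontrivial_iff_exists_ne_zero.mpr ⟨x, AddSubgroup.mem_zmultiples x, hx⟩
      exact Finite.one_lt_card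
    rw [← hc, hcard]
    exact (Nat.lt_mul_iff_one_lt_right Nat.card_pos).mpr hL1

theorem of_odd_card_ker {π : A →+ B} (hπ : Function.Surjective π) (hodd : Odd (Nat.card π.ker))
    (hB : IsCyclicallyHarmonious B) : IsCyclicallyHarmonious A :=
  of_odd_ker hπ hodd (of_odd_card hodd) hB

end IsCyclicallyHarmonious

/-! ### Kernels of exponent two -/

section Strands

variable {n N : ℕ} [NeZero n] [NeZero N] {T : Type*}

/-- The point at which the `j`-th of `N` strands leaves level `i`, the point `c 0 j` being where a
walk along the strands, upwards on the even ones and downwards on the odd ones, enters the `j`-th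
strand. Level `0` is both the bottom and the top level, and a strand of odd index leaves it where
the next strand is entered. -/
def strandStart (c : Fin n → Fin N → T) (i : Fin n) (j : Fin N) : T :=
  if i = 0 ∧ Odd j.val then c 0 (j + 1) else c i j

/-- The point at which the `j`-th of `N` strands arrives at level `i`; see `strandStart`. -/
def strandEnd (c : Fin n → Fin N → T) (i : Fin n) (j : Fin N) : T :=
  if i = 0 ∧ Even j.val then c 0 (j + 1) else c i j

/-- The walk along the strands `c`, upwards on the even ones and downwards on the odd ones. -/
def strandWalk (c : Fin n → Fin N → T) (x : Fin N × Fin n) : T :=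
  c (if Even x.1.val then x.2 else -x.2) x.1

/-- Strands in `T` that have distinct points at each level and distinct sums along the steps
between any two consecutive levels. -/
structure IsStrandSystem [AddCommGroup T] (c : Fin n → Fin N → T) : Prop where
  injective (i : Fin n) : Function.Injective (c i)
  injective_add (i : Fin n) : Function.Injective fun j => strandStart c i j + strandEnd c (i + 1) j

/-- The lower level of the step of `strandWalk` that leaves the cell `x`. -/
def strandStep (x : Fin N × Fin n) : Fin n :=
  if Even x.1.val then x.2 else -(x.2 + 1)

theorem strandWalk_add_strandWalk_nextCell [AddCommGroup T] (c : Fin n → Fin N → T)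
    (x : Fin N × Fin n) : strandWalk c x + strandWalk c (nextCell x) =
      strandStart c (strandStep x) x.1 + strandEnd c (strandStep x + 1) x.1 := by
  obtain ⟨j, i⟩ := x
  have hnext : strandWalk c (nextCell (j, i)) =
      if i + 1 = 0 then c 0 (j + 1) else strandWalk c (j, i + 1) := by
    split_ifs with hi <;> simp [strandWalk, nextCell, hi]
  rw [hnext]
  by_cases hj : Even j.val
  · simp [strandWalk, strandStep, strandStart, strandEnd, hj]
  · have htop : -(i + 1) + 1 = -i := by abel
    simp only [strandWalk, strandStep, strandStart, strandEnd, hj, Nat.not_even_iff_odd.mp hj,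
      if_false, and_true, and_false, neg_eq_zero, htop, add_comm]

theorem IsCyclicallyHarmonious.of_isStrandSystem {A B : Type*} [AddCommGroup A] [AddCommGroup B]
    [AddCommGroup T] {π : A →+ B} (hπ : Function.Surjective π) (hN : Nat.card π.ker = N)
    {ι : T →+ π.ker} (hι : Function.Injective ι) {a : Fin n ≃ B}
    (ha : Function.Injective fun k => a k + a (k + 1)) {c : Fin n → Fin N → T}
    (hc : IsStrandSystem c) : IsCyclicallyHarmonious A := by
  have hcard : Nat.card A = N * n := by
    rw [← card_ker_mul_card_of_surjective hπ, hN, ← Nat.card_congr a, Nat.card_fin]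
  set ℓ := Function.surjInv hπ
  have hℓ (x : B) : π (ℓ x) = x := Function.surjInv_eq hπ x
  have hπι (t : T) : π (ι t) = 0 := (ι t).2
  have hι' {t t' : T} (h : (ι t : A) = ι t') : t = t' := hι (Subtype.ext h)
  let d (i : Fin n) (j : Fin N) : A := ℓ (a i) + ι (c i j)
  have hd (x) : strandWalk d x + strandWalk d (nextCell x) =
      ℓ (a (strandStep x)) + ℓ (a (strandStep x + 1)) +
        ↑(ι (strandStart c (strandStep x) x.1 + strandEnd c (strandStep x + 1) x.1)) := by
    have hstart (i j) : strandStart d i j = ℓ (a i) + ι (strandStart c i j) := by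
      simp only [strandStart, d]; split_ifs with h <;> simp [h]
    have hend (i j) : strandEnd d i j = ℓ (a i) + ι (strandEnd c i j) := by
      simp only [strandEnd, d]; split_ifs with h <;> simp [h]
    rw [strandWalk_add_strandWalk_nextCell, hstart, hend, add_add_add_comm, map_add ι,
      AddSubgroup.coe_add]
  refine .of_grid hcard (strandWalk d) (fun x y hxy => ?_) fun x y hxy => ?_
  · have hlevel := a.injective (by simpa [strandWalk, d, hℓ, hπι] using congrArg π hxy)
    have hrow : x.1 = y.1 := hc.injective _ (hι' (by simpa [strandWalk, d, hlevel] using hxy))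
    refine Prod.ext hrow ?_
    rw [hrow] at hlevel
    split_ifs at hlevel <;> simpa using hlevel
  · simp only [hd] at hxy
    have hstep : strandStep x = strandStep y :=
      ha (by simpa [hℓ, hπι] using congrArg π hxy)
    have hrow : x.1 = y.1 := hc.injective_add _ (hι' (by simpa [hstep] using hxy))
    refine Prod.ext hrow ?_
    simp only [strandStep, hrow] at hstep
    split_ifs at hstep <;> simpa using hstep

/-- Lists of `N` points from which strands with any number `n ≥ 3` of levels can be stacked: `t` at
level `0`, `u` at level `1`, and then `v` and `w` alternately, with `v` at level `n - 1`. -/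
structure IsStrandPattern [AddCommGroup T] (t u v w : Fin N → T) : Prop where
  injective_t : Function.Injective t
  injective_u : Function.Injective u
  injective_v : Function.Injective v
  injective_w : Function.Injective w
  injective_t_add_u : Function.Injective fun j => (if Odd j.val then t (j + 1) else t j) + u j
  injective_u_add_v : Function.Injective fun j => u j + v j
  injective_u_add_w : Function.Injective fun j => u j + w j
  injective_v_add_w : Function.Injective fun j => v j + w j
  injective_v_add_t : Function.Injective fun j => v j + (if Even j.val then t (j + 1) else t j)

theorem IsStrandPattern.exists_isStrandSystem [AddCommGroup T] {t u v w : Fin N → T}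
    (h : IsStrandPattern t u v w) (hn : 3 ≤ n) : ∃ c : Fin n → Fin N → T, IsStrandSystem c := by
  refine ⟨fun i => if i.val = 0 then t else if i.val = 1 then u else
    if Odd (n + i.val) then v else w, fun i => ?_, fun i => ?_⟩
  · have := h.injective_t; have := h.injective_u
    have := h.injective_v; have := h.injective_w
    split_ifs <;> assumption
  · have hi := i.isLt
    simp only [strandStart, strandEnd, Fin.ext_iff, val_add_one_eq_ite, Fin.val_zero]
    obtain h0 | h1 | ⟨h0, h1, hlast⟩ | ⟨h0, h1, hlast⟩ : i.val = 0 ∨ i.val = 1 ∨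
        (i.val ≠ 0 ∧ i.val ≠ 1 ∧ i.val + 1 = n) ∨
        (i.val ≠ 0 ∧ i.val ≠ 1 ∧ i.val + 1 ≠ n) := by omega
    · have hn1 : 0 + 1 ≠ n := by omega
      simpa [h0, hn1] using h.injective_t_add_u
    · have hn2 : 1 + 1 ≠ n := by omega
      by_cases hn' : Odd (n + 2)
      · simpa [h1, hn2, hn'] using h.injective_u_add_v
      · simpa [h1, hn2, hn'] using h.injective_u_add_w
    · have hv : Odd (n + i.val) := ⟨i.val, by omega⟩
      simpa [hlast, hv, h0, h1] using h.injective_v_add_t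
    · by_cases hv : Odd (n + i.val)
      · have hw : ¬ Odd (n + (i.val + 1)) := by grind
        simpa [hlast, hv, hw, h0, h1] using h.injective_v_add_w
      · have hw : Odd (n + (i.val + 1)) := by grind
        simpa [hlast, hv, hw, h0, h1, add_comm] using
          h.injective_v_add_w

/-- The `r` lowest binary digits of `k`, so that addition is the bitwise exclusive or. -/
def binaryDigits (r k : ℕ) : Fin r → ZMod 2 :=
  fun i => (k / 2 ^ i.val : ℕ)

theorem isStrandPattern_four :
    IsStrandPattern (binaryDigits 2 ∘ ![0, 1, 2, 3]) (binaryDigits 2 ∘ ![1, 0, 2, 3])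
      (binaryDigits 2 ∘ ![2, 0, 3, 1]) (binaryDigits 2 ∘ ![3, 0, 1, 2]) := by
  constructor <;> decide

theorem isStrandPattern_eight :
    IsStrandPattern (binaryDigits 3 ∘ ![0, 2, 1, 3, 4, 5, 7, 6])
      (binaryDigits 3 ∘ ![1, 7, 5, 6, 3, 2, 4, 0]) (binaryDigits 3 ∘ ![2, 5, 1, 7, 6, 4, 3, 0])
      (binaryDigits 3 ∘ ![4, 1, 2, 5, 7, 3, 6, 0]) := by
  constructor <;> decide +kernel

end Strands

theorem card_mul_card_ker_lift {A B : Type*} [AddCommGroup A] [AddCommGroup B] [Finite B]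
    {π : A →+ B} (hπ : Function.Surjective π) {L : AddSubgroup A} (hL : L ≤ π.ker) :
    Nat.card L * Nat.card (QuotientAddGroup.lift L π hL).ker = Nat.card π.ker := by
  have hlift := card_ker_mul_card_of_surjective
    (QuotientAddGroup.lift_surjective_of_surjective L π hπ hL)
  refine Nat.eq_of_mul_eq_mul_right (Nat.card_pos (α := B)) ?_
  rw [mul_assoc, hlift, mul_comm, ← L.card_eq_card_quotient_mul_card_addSubgroup,
    card_ker_mul_card_of_surjective hπ]

theorem exists_natCard_eq_two_pow {L : Type*} [AddCommGroup L] [Finite L]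
    (h2 : ∀ x : L, x + x = 0) :
    ∃ r : ℕ, Nat.card L = 2 ^ r ∧ Nonempty ((Fin r → ZMod 2) ≃+ L) := by
  let _ : Module (ZMod 2) L := AddCommGroup.zmodModule fun x => by rw [two_nsmul, h2]
  let e := (Module.finBasis (ZMod 2) L).equivFun.symm.toAddEquiv
  exact ⟨_, by simp [← Nat.card_congr e.toEquiv], ⟨e⟩⟩

theorem exists_addSubgroup_le_card_eq_pow {A : Type*} [AddCommGroup A] {K : AddSubgroup A}
    [Finite K] {p r : ℕ} [Fact p.Prime] (hK : p ^ r ∣ Nat.card K) :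
    ∃ L ≤ K, Nat.card L = p ^ r := by
  have : Finite (Multiplicative K) := ‹Finite K›
  obtain ⟨L, hL⟩ := Sylow.exists_subgroup_card_pow_prime (G := Multiplicative K) p hK
  refine ⟨(Subgroup.toAddSubgroup' L).map K.subtype, AddSubgroup.map_subtype_le _, ?_⟩
  rw [← hL]
  exact Nat.card_congr (AddSubgroup.equivMapOfInjective _ _ K.subtype_injective).symm.toEquiv

namespace IsCyclicallyHarmonious

variable {A B : Type*} [AddCommGroup A] [AddCommGroup B] {π : A →+ B}

theorem of_isStrandPattern (hπ : Function.Surjective π) (h2 : ∀ x, π x = 0 → x + x = 0) {r : ℕ}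
    (hr : Nat.card π.ker = 2 ^ r) {t u v w : Fin (2 ^ r) → Fin r → ZMod 2}
    (h : IsStrandPattern t u v w) (hB3 : 3 ≤ Nat.card B) (hB : IsCyclicallyHarmonious B) :
    IsCyclicallyHarmonious A := by
  have : Finite π.ker := Nat.finite_of_card_ne_zero (by rw [hr]; positivity)
  obtain ⟨s, hs, ⟨e⟩⟩ := exists_natCard_eq_two_pow fun x : π.ker => Subtype.ext (h2 x x.2)
  obtain rfl : r = s := Nat.pow_right_injective le_rfl (hr.symm.trans hs)
  obtain ⟨n, _, a, ha⟩ := hB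
  rw [← Nat.card_congr a, Nat.card_fin] at hB3
  obtain ⟨c, hc⟩ := h.exists_isStrandSystem hB3
  exact of_isStrandSystem hπ hr (ι := e.toAddMonoidHom) e.injective ha hc

theorem of_exponent_two_ker (hπ : Function.Surjective π) (h2 : ∀ x, π x = 0 → x + x = 0)
    (hker : 2 < Nat.card π.ker) (hB3 : 3 ≤ Nat.card B) (hB : IsCyclicallyHarmonious B) :
    IsCyclicallyHarmonious A := by
  obtain ⟨r, hr⟩ : ∃ r, Nat.card π.ker = 2 ^ r := by
    have : Finite π.ker := Nat.finite_of_card_ne_zero (by omega)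
    obtain ⟨r, hr, -⟩ := exists_natCard_eq_two_pow fun x : π.ker => Subtype.ext (h2 x x.2)
    exact ⟨r, hr⟩
  induction r using Nat.strong_induction_on generalizing A with
  | _ r ih =>
    match r with
    | 0 | 1 => omega
    | 2 => exact of_isStrandPattern hπ h2 hr isStrandPattern_four hB3 hB
    | 3 => exact of_isStrandPattern hπ h2 hr isStrandPattern_eight hB3 hB
    | r + 4 =>
      have : Finite B := hB.finite
      have : Finite π.ker := Nat.finite_of_card_ne_zero (by omega)
      have hdvd : 2 ^ 2 ∣ Nat.card π.ker := hr ▸ pow_dvd_pow 2 (by omega)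
      obtain ⟨L, hLker, hL⟩ := exists_addSubgroup_le_card_eq_pow hdvd
      have hmk := QuotientAddGroup.mk'_surjective L
      let ρ : A ⧸ L →+ B := QuotientAddGroup.lift L π hLker
      have hρ : Function.Surjective ρ :=
        QuotientAddGroup.lift_surjective_of_surjective L π hπ hLker
      have hkerρ : Nat.card ρ.ker = 2 ^ (r + 2) := by
        have hmul := card_mul_card_ker_lift hπ hLker
        rw [hL, hr, show r + 4 = 2 + (r + 2) by ring, pow_add] at hmul
        exact Nat.eq_of_mul_eq_mul_left (by norm_num) hmul
      have h2ρ (x : A ⧸ L) (hx : ρ x = 0) : x + x = 0 := by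
        obtain ⟨y, rfl⟩ := hmk x
        rw [← map_add, h2 y hx, map_zero]
      have hquot : IsCyclicallyHarmonious (A ⧸ L) :=
        ih (r + 2) (by omega) hρ h2ρ (hkerρ ▸ lt_self_pow₀ one_lt_two (by omega)) hkerρ
      have := hquot.finite
      have hquot3 := hB3.trans (Nat.card_le_card_of_surjective ρ hρ)
      exact of_isStrandPattern hmk (fun x hx => h2 x (hLker (by simpa using hx)))
        (by rwa [QuotientAddGroup.ker_mk']) isStrandPattern_four hquot3 hquot

end IsCyclicallyHarmonious

/-! ### Base cases -/

/-- The `k`-th entry of a cyclic listing of `ZMod 2 × ZMod (4 * h)`, in least residues: the second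
coordinate runs once through all residues, and then zigzags through the remaining pairs. -/
def twoByFourEntry (h k : ℕ) : ℕ × ℕ :=
  if k < 4 * h then (if 2 * h < k ∧ k % 2 = 1 then 1 else 0, k)
  else if k < 6 * h then
    if k % 2 = 0 then (1, 6 * h - 1 - k) else (0, 8 * h - k)
  else
    if k % 2 = 0 then (1, 8 * h - 2 - k) else (1, 10 * h - 1 - k)

/-- The sum of the entries `k` and `k + 1` of the listing `twoByFourEntry`, in least residues. -/
def twoByFourSum (h k : ℕ) : ℕ × ℕ :=
  if k < 2 * h then (0, 2 * k + 1)
  else if k + 1 < 4 * h then (1, 2 * k + 1 - 4 * h)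
  else if k + 1 = 4 * h then (0, 2 * h - 2)
  else if k < 5 * h then (1, 10 * h - 2 - 2 * k)
  else if k + 1 < 6 * h then (1, 14 * h - 2 - 2 * k)
  else if k + 1 = 6 * h then (1, 4 * h - 1)
  else if k + 1 < 7 * h then (0, 14 * h - 4 - 2 * k)
  else if k + 1 < 8 * h then (0, 18 * h - 4 - 2 * k)
  else (1, 2 * h)

theorem twoByFourEntry_injOn (h : ℕ) : Set.InjOn (twoByFourEntry h) (Set.Iio (8 * h)) := by
  intro k hk l hl hkl
  simp only [twoByFourEntry, Set.mem_Iio] at hk hl hkl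
  split_ifs at hkl <;> simp only [Prod.mk.injEq] at hkl <;> omega

theorem twoByFourSum_injOn (h : ℕ) : Set.InjOn (twoByFourSum h) (Set.Iio (8 * h)) := by
  let index (x : ℕ × ℕ) : ℕ :=
    if x.2 % 2 = 1 then
      if x.1 = 0 then x.2 / 2 else if x.2 + 1 = 4 * h then 6 * h - 1 else (x.2 + 4 * h) / 2
    else if x.1 = 0 then
      if x.2 + 2 = 2 * h then 4 * h - 1
      else if x.2 < 2 * h then (14 * h - 4 - x.2) / 2 else (18 * h - 4 - x.2) / 2
    else
      if x.2 = 2 * h then 8 * h - 1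
      else if x.2 < 2 * h then (10 * h - 2 - x.2) / 2 else (14 * h - 2 - x.2) / 2
  refine Set.LeftInvOn.injOn (f₁' := index) fun k hk => ?_
  rw [Set.mem_Iio] at hk
  unfold twoByFourSum
  split_ifs <;> simp only [index, one_ne_zero, if_true, if_false] <;>
    split_ifs <;> omega

theorem twoByFourEntry_fst_add_mod_two {h k : ℕ} (hk : k + 1 < 8 * h) :
    ((twoByFourEntry h k).1 + (twoByFourEntry h (k + 1)).1) % 2 = (twoByFourSum h k).1 := by
  unfold twoByFourEntry twoByFourSum
  split_ifs <;> simp only [] <;> omega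

theorem twoByFourEntry_snd_add {h k : ℕ} (hk : k + 1 < 8 * h) :
    (twoByFourEntry h k).2 + (twoByFourEntry h (k + 1)).2 = (twoByFourSum h k).2 +
      if 2 * h ≤ k ∧ k < 5 * h ∨ 6 * h ≤ k ∧ k + 1 < 7 * h then 4 * h else 0 := by
  have hsum : (twoByFourEntry h k).2 + (twoByFourEntry h (k + 1)).2 =
      if k + 1 < 4 * h then 2 * k + 1
      else if k + 1 = 4 * h then 6 * h - 2
      else if k + 1 < 6 * h then 14 * h - 2 - 2 * k
      else if k + 1 = 6 * h then 4 * h - 1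
      else 18 * h - 4 - 2 * k := by
    unfold twoByFourEntry
    split_ifs <;> simp only [] <;> omega
  rw [hsum]
  unfold twoByFourSum
  split_ifs <;> simp only [] <;> omega

/-- The element of `ZMod 2 × ZMod (4 * h)` with given residues. -/
def castTwoByFour (h : ℕ) (x : ℕ × ℕ) : ZMod 2 × ZMod (4 * h) :=
  (x.1, x.2)

theorem castTwoByFour_injOn (h : ℕ) :
    Set.InjOn (castTwoByFour h) (Set.Iio 2 ×ˢ Set.Iio (4 * h)) := by
  rintro x ⟨hx1, hx2⟩ y ⟨hy1, hy2⟩ hxy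
  simp only [castTwoByFour, Prod.mk.injEq, ZMod.natCast_eq_natCast_iff',
    Nat.mod_eq_of_lt hx1, Nat.mod_eq_of_lt hy1, Nat.mod_eq_of_lt hx2, Nat.mod_eq_of_lt hy2] at hxy
  exact Prod.ext hxy.1 hxy.2

theorem mapsTo_twoByFourEntry (h : ℕ) :
    Set.MapsTo (twoByFourEntry h) (Set.Iio (8 * h)) (Set.Iio 2 ×ˢ Set.Iio (4 * h)) := by
  intro k hk
  simp only [twoByFourEntry, Set.mem_Iio, Set.mem_prod] at hk ⊢
  split_ifs <;> constructor <;> simp only [] <;> omega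

theorem mapsTo_twoByFourSum (h : ℕ) :
    Set.MapsTo (twoByFourSum h) (Set.Iio (8 * h)) (Set.Iio 2 ×ˢ Set.Iio (4 * h)) := by
  intro k hk
  simp only [twoByFourSum, Set.mem_Iio, Set.mem_prod] at hk ⊢
  split_ifs <;> constructor <;> simp only [] <;> omega

theorem castTwoByFour_add {h k : ℕ} (hk : k < 8 * h) :
    castTwoByFour h (twoByFourEntry h k) +
      castTwoByFour h (twoByFourEntry h (if k + 1 = 8 * h then 0 else k + 1)) =
        castTwoByFour h (twoByFourSum h k) := by
  split_ifs with hlast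
  · have hfirst : twoByFourEntry h 0 = (0, 0) := by
      simp [twoByFourEntry, show 0 < h by omega]
    have hend : twoByFourEntry h k = (1, 2 * h) := by
      unfold twoByFourEntry
      split_ifs <;> simp only [Prod.mk.injEq, true_and] <;> omega
    have hsum : twoByFourSum h k = (1, 2 * h) := by
      unfold twoByFourSum
      split_ifs <;> simp only [Prod.mk.injEq, true_and] <;> omega
    simp [hfirst, hend, hsum, castTwoByFour]
  · have hk' : k + 1 < 8 * h := by omega
    simp only [castTwoByFour, Prod.mk_add_mk, ← Nat.cast_add, twoByFourEntry_snd_add hk',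
      ← twoByFourEntry_fst_add_mod_two hk', ZMod.natCast_mod]
    split_ifs
    · rw [Nat.cast_add _ (4 * h), ZMod.natCast_self, add_zero]
    · rw [add_zero]

theorem isCyclicallyHarmonious_zmod_two_prod_zmod_four_mul {h : ℕ} (hh : 0 < h) :
    IsCyclicallyHarmonious (ZMod 2 × ZMod (4 * h)) := by
  have : NeZero (8 * h) := ⟨by omega⟩
  refine .of_injective (n := 8 * h) (by simp only [Nat.card_prod, Nat.card_zmod]; ring)
    (fun k => castTwoByFour h (twoByFourEntry h k)) (fun k l hkl => ?_) fun k l hkl => ?_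
  · exact Fin.ext (((castTwoByFour_injOn h).comp (twoByFourEntry_injOn h)
      (mapsTo_twoByFourEntry h)) k.isLt l.isLt hkl)
  · simp only [val_add_one_eq_ite, castTwoByFour_add k.isLt, castTwoByFour_add l.isLt] at hkl
    exact Fin.ext (((castTwoByFour_injOn h).comp (twoByFourSum_injOn h)
      (mapsTo_twoByFourSum h)) k.isLt l.isLt hkl)

theorem isCyclicallyHarmonious_zmod_four_prod_zmod_four :
    IsCyclicallyHarmonious (ZMod 4 × ZMod 4) := by
  refine .of_injective (n := 16) (by simp)
    ![(0, 0), (2, 0), (3, 2), (2, 2), (3, 1), (3, 0), (1, 1), (1, 2),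
      (0, 3), (0, 1), (2, 1), (1, 3), (2, 3), (1, 0), (3, 3), (0, 2)] ?_ ?_ <;> decide +kernel

theorem isCyclicallyHarmonious_zmod_two_prod_zmod_two_prod_zmod_four :
    IsCyclicallyHarmonious (ZMod 2 × ZMod 2 × ZMod 4) := by
  refine .of_injective (n := 16) (by simp)
    ![(0, 0, 0), (1, 1, 1), (1, 1, 0), (0, 1, 0), (1, 0, 2), (0, 0, 1), (0, 1, 1), (0, 1, 2),
      (0, 0, 3), (1, 0, 3), (1, 0, 1), (1, 1, 3), (1, 0, 0), (0, 1, 3), (1, 1, 2), (0, 0, 2)]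
    ?_ ?_ <;> decide +kernel

/-! ### Products of cyclic 2-groups -/

theorem add_self_eq_zero_of_castHom_eq_zero {q q' : ℕ} (h : q' ∣ q) (h' : q ∣ 2 * q') {x : ZMod q}
    (hx : ZMod.castHom h (ZMod q') x = 0) : x + x = 0 := by
  obtain ⟨z, rfl⟩ := ZMod.intCast_surjective x
  rw [map_intCast, ZMod.intCast_zmod_eq_zero_iff_dvd] at hx
  rw [← two_mul, ← Int.cast_ofNat, ← Int.cast_mul, ZMod.intCast_zmod_eq_zero_iff_dvd]
  calc (q : ℤ) ∣ 2 * q' := mod_cast h'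
    _ ∣ 2 * z := mul_dvd_mul_left 2 hx

section PiZMod

variable {I : Type*}

theorem isCyclicallyHarmonious_pi_zmod_of_dvd_two_mul [Fintype I] {q q' : I → ℕ}
    (h : ∀ x, q' x ∣ q x) (h' : ∀ x, q x ∣ 2 * q' x) (hlt : 2 * ∏ x, q' x < ∏ x, q x)
    (h3 : 3 ≤ ∏ x, q' x) (hB : IsCyclicallyHarmonious (∀ x, ZMod (q' x))) :
    IsCyclicallyHarmonious (∀ x, ZMod (q x)) := by
  let π : (∀ x, ZMod (q x)) →+ ∀ x, ZMod (q' x) :=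
    AddMonoidHom.piMap fun x => (ZMod.castHom (h x) (ZMod (q' x))).toAddMonoidHom
  have hπ : Function.Surjective π :=
    Function.Surjective.piMap fun x => ZMod.castHom_surjective (h x)
  have hcard := card_ker_mul_card_of_surjective hπ
  simp only [Nat.card_pi, Nat.card_zmod] at hcard
  refine .of_exponent_two_ker hπ (fun x hx => funext fun i => ?_)
    (lt_of_mul_lt_mul_right (hcard ▸ hlt) (Nat.zero_le _)) (by simpa [Nat.card_pi] using h3) hB
  exact add_self_eq_zero_of_castHom_eq_zero (h i) (h' i) (congrFun hx i)

theorem isCyclicallyHarmonious_pi_zmod_of_pair {q : I → ℕ} {i k : I} (hik : i ≠ k)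
    (h1 : ∀ x, x ≠ i → x ≠ k → q x = 1) (h : IsCyclicallyHarmonious (ZMod (q i) × ZMod (q k))) :
    IsCyclicallyHarmonious (∀ x, ZMod (q x)) := by
  classical
  let π (x : I) := Pi.evalAddMonoidHom (fun x => ZMod (q x)) x
  refine h.of_addEquiv (AddEquiv.ofBijective ((π i).prod (π k)) ⟨?_, fun ⟨a, b⟩ => ?_⟩).symm
  · intro x y hxy
    obtain ⟨hi, hk⟩ : x i = y i ∧ x k = y k := by simpa [π] using hxy
    ext z
    by_cases hz : z = i ∨ z = k
    · obtain rfl | rfl := hz <;> assumption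
    · have : Subsingleton (ZMod (q z)) := by
        rw [h1 z (by tauto) (by tauto)]; infer_instance
      exact Subsingleton.elim _ _
  · exact ⟨Pi.single i a + Pi.single k b, by simp [π, hik, hik.symm]⟩

theorem isCyclicallyHarmonious_pi_zmod_of_triple {q : I → ℕ} {i l k : I} (hil : i ≠ l)
    (hik : i ≠ k) (hlk : l ≠ k) (h1 : ∀ x, x ≠ i → x ≠ l → x ≠ k → q x = 1)
    (h : IsCyclicallyHarmonious (ZMod (q i) × ZMod (q l) × ZMod (q k))) :
    IsCyclicallyHarmonious (∀ x, ZMod (q x)) := by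
  classical
  let π (x : I) := Pi.evalAddMonoidHom (fun x => ZMod (q x)) x
  refine h.of_addEquiv
    (AddEquiv.ofBijective ((π i).prod ((π l).prod (π k))) ⟨?_, fun ⟨a, b, c⟩ => ?_⟩).symm
  · intro x y hxy
    obtain ⟨hi, hl, hk⟩ : x i = y i ∧ x l = y l ∧ x k = y k := by simpa [π] using hxy
    ext z
    by_cases hz : z = i ∨ z = l ∨ z = k
    · obtain rfl | rfl | rfl := hz <;> assumption
    · have : Subsingleton (ZMod (q z)) := by
        rw [h1 z (by tauto) (by tauto) (by tauto)]; infer_instance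
      exact Subsingleton.elim _ _
  · refine ⟨Pi.single i a + Pi.single l b + Pi.single k c, ?_⟩
    simp [π, hil, hil.symm, hik, hik.symm, hlk, hlk.symm]

/-- The exponents `e` are such that `∏ x, ZMod (2 ^ e x)` is not cyclic and has an element of
order four. -/
def IsAdmissible (e : I → ℕ) : Prop :=
  ∃ i k, i ≠ k ∧ 1 ≤ e i ∧ 2 ≤ e k

open Classical in
/-- The exponents that arise from `e` when its values at `i` and `j` are lowered by one. -/
noncomputable def lowerPair (e : I → ℕ) (i j : I) (x : I) : ℕ :=
  if x = i ∨ x = j then e x - 1 else e x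

theorem sum_lowerPair_add_two [Fintype I] {e : I → ℕ} {i j : I} (hij : i ≠ j) (hi : 1 ≤ e i)
    (hj : 1 ≤ e j) : ∑ x, lowerPair e i j x + 2 = ∑ x, e x := by
  classical
  have hadd (x : I) : e x = lowerPair e i j x + if x ∈ ({i, j} : Finset I) then 1 else 0 := by
    simp only [lowerPair, Finset.mem_insert, Finset.mem_singleton]
    split_ifs with hx
    · obtain rfl | rfl := hx <;> omega
    · rfl
  rw [Finset.sum_congr rfl fun x _ => hadd x, Finset.sum_add_distrib, Finset.sum_ite_mem,
    Finset.univ_inter, Finset.sum_const, Finset.card_pair hij, smul_eq_mul, mul_one]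

theorem IsAdmissible.three_le_sum [Fintype I] {e : I → ℕ} (he : IsAdmissible e) :
    3 ≤ ∑ x, e x := by
  obtain ⟨i, k, hik, hi, hk⟩ := he
  exact (add_le_add hi hk).trans
    (Finset.add_le_sum (fun _ _ => Nat.zero_le _) (Finset.mem_univ i) (Finset.mem_univ k) hik)

theorem IsAdmissible.exists_lowerPair_or {e : I → ℕ} (he : IsAdmissible e) :
    (∃ i j, i ≠ j ∧ 1 ≤ e i ∧ 1 ≤ e j ∧ IsAdmissible (lowerPair e i j)) ∨
    (∃ i k, i ≠ k ∧ (∀ x, x ≠ i → x ≠ k → e x = 0) ∧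
      (e i = 1 ∧ 2 ≤ e k ∨ e i = 2 ∧ e k = 2)) ∨
    ∃ i l k, i ≠ l ∧ i ≠ k ∧ l ≠ k ∧ (∀ x, x ≠ i → x ≠ l → x ≠ k → e x = 0) ∧
      e i = 1 ∧ e l = 1 ∧ e k = 2 := by
  obtain ⟨i, k, hik, hi, hk⟩ := he
  refine or_iff_not_imp_left.mpr fun hno => ?_
  have hirr (a b c d : I) (hab : a ≠ b) (ha : 1 ≤ e a) (hb : 1 ≤ e b) (hcd : c ≠ d)
      (hc : 1 ≤ lowerPair e a b c) : lowerPair e a b d < 2 := by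
    by_contra! hd
    exact hno ⟨a, b, hab, ha, hb, c, d, hcd, hc, hd⟩
  clear hno
  simp only [lowerPair] at hirr
  by_cases hl : ∃ l, l ≠ i ∧ l ≠ k ∧ 1 ≤ e l
  · obtain ⟨l, hli, hlk, hl⟩ := hl
    have hi1 : e i = 1 := by have := hirr i l i k; grind
    have hl1 : e l = 1 := by have := hirr i l l k; grind
    have hk2 : e k = 2 := by have := hirr l k i k; grind
    refine .inr ⟨i, l, k, hli.symm, hik, hlk, fun x hxi hxl hxk => ?_, hi1, hl1, hk2⟩
    have := hirr x l i k
    grind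
  · have hzero (x : I) (hxi : x ≠ i) (hxk : x ≠ k) : e x = 0 := by grind
    refine .inl ⟨i, k, hik, hzero, ?_⟩
    have := hirr i k i k
    have := hirr i k k i
    grind

theorem isCyclicallyHarmonious_pi_zmod_two_pow_of_lowerPair [Fintype I] {e : I → ℕ} {i j : I}
    (hij : i ≠ j) (hi : 1 ≤ e i) (hj : 1 ≤ e j) (hsum : 2 ≤ ∑ x, lowerPair e i j x)
    (h : IsCyclicallyHarmonious (∀ x, ZMod (2 ^ lowerPair e i j x))) :
    IsCyclicallyHarmonious (∀ x, ZMod (2 ^ e x)) := by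
  have hle (x : I) : lowerPair e i j x ≤ e x ∧ e x ≤ lowerPair e i j x + 1 := by
    unfold lowerPair
    split_ifs <;> omega
  refine isCyclicallyHarmonious_pi_zmod_of_dvd_two_mul (fun x => pow_dvd_pow 2 (hle x).1)
    (fun x => ?_) ?_ ?_ h
  · rw [← pow_succ']
    exact pow_dvd_pow 2 (hle x).2
  · rw [Finset.prod_pow_eq_pow_sum, Finset.prod_pow_eq_pow_sum, ← pow_succ',
      ← sum_lowerPair_add_two hij hi hj]
    exact Nat.pow_lt_pow_right one_lt_two (by omega)
  · rw [Finset.prod_pow_eq_pow_sum]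
    calc 3 ≤ 2 ^ 2 := by norm_num
      _ ≤ _ := Nat.pow_le_pow_right two_pos hsum

theorem IsAdmissible.isCyclicallyHarmonious_pi_zmod_two_pow [Finite I] {e : I → ℕ}
    (he : IsAdmissible e) : IsCyclicallyHarmonious (∀ x, ZMod (2 ^ e x)) := by
  have := Fintype.ofFinite I
  induction hs : ∑ x, e x using Nat.strong_induction_on generalizing e with
  | _ s ih =>
    obtain ⟨i, j, hij, hi, hj, he'⟩ | ⟨i, k, hik, hzero, hbase⟩ |
      ⟨i, l, k, hil, hik, hlk, hzero, hi, hl, hk⟩ := he.exists_lowerPair_or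
    · have hlt := sum_lowerPair_add_two hij hi hj
      have h3 := he'.three_le_sum
      exact isCyclicallyHarmonious_pi_zmod_two_pow_of_lowerPair hij hi hj (by omega)
        (ih _ (by omega) he' rfl)
    · refine isCyclicallyHarmonious_pi_zmod_of_pair hik
        (fun x hxi hxk => by rw [hzero x hxi hxk, pow_zero]) ?_
      obtain ⟨hi, hk⟩ | ⟨hi, hk⟩ := hbase
      · rw [hi, ← Nat.add_sub_cancel' hk, pow_add]
        exact isCyclicallyHarmonious_zmod_two_prod_zmod_four_mul (by positivity)
      · rw [hi, hk]
        exact isCyclicallyHarmonious_zmod_four_prod_zmod_four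
    · refine isCyclicallyHarmonious_pi_zmod_of_triple hil hik hlk
        (fun x hxi hxl hxk => by rw [hzero x hxi hxl hxk, pow_zero]) ?_
      rw [hi, hl, hk]
      exact isCyclicallyHarmonious_zmod_two_prod_zmod_two_prod_zmod_four

end PiZMod

/-! ### Groups with more than two elements killed by doubling -/

theorem prime_dvd_of_nsmul_eq_zero {A : Type*} [AddCommGroup A] [Finite A] {n p : ℕ}
    (hp : p.Prime) (hA : ∀ x : A, n • x = 0) (hdvd : p ∣ Nat.card A) : p ∣ n := by
  have := Fact.mk hp
  obtain ⟨x, hx⟩ := exists_prime_addOrderOf_dvd_card' p hdvd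
  exact hx ▸ addOrderOf_dvd_of_nsmul_eq_zero (hA x)

theorem odd_card_of_nsmul_eq_zero {A : Type*} [AddCommGroup A] [Finite A] {m : ℕ} (hm : Odd m)
    (hA : ∀ x : A, m • x = 0) : Odd (Nat.card A) :=
  Nat.not_even_iff_odd.mp fun h => Nat.not_even_iff_odd.mpr hm <| even_iff_two_dvd.mpr <|
    prime_dvd_of_nsmul_eq_zero Nat.prime_two hA h.two_dvd

theorem exists_card_eq_two_pow_of_nsmul_eq_zero {A : Type*} [AddCommGroup A] [Finite A] {k : ℕ}
    (hA : ∀ x : A, 2 ^ k • x = 0) : ∃ l, Nat.card A = 2 ^ l :=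
  ⟨_, Nat.eq_prime_pow_of_unique_prime_dvd Nat.card_pos.ne' fun hd hdvd =>
    (Nat.prime_dvd_prime_iff_eq hd Nat.prime_two).mp <|
      hd.dvd_of_dvd_pow (prime_dvd_of_nsmul_eq_zero hd hA hdvd)⟩

theorem exists_addEquiv_pi_zmod_two_pow {A : Type*} [AddCommGroup A] {k : ℕ}
    (hA : Nat.card A = 2 ^ k) :
    ∃ (I : Type) (_ : Fintype I) (e : I → ℕ), Nonempty (A ≃+ ∀ x, ZMod (2 ^ e x)) := by
  have : Finite A := Nat.finite_of_card_ne_zero (hA ▸ (Nat.two_pow_pos k).ne')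
  obtain ⟨I, _, p, -, f, ⟨φ⟩⟩ := AddCommGroup.equiv_directSum_zmod_of_finite A
  let ψ : A ≃+ ∀ x, ZMod (p x ^ f x) := φ.trans (DirectSum.addEquivProd _)
  have hcard : ∏ x, p x ^ f x = 2 ^ k := by
    rw [← hA, Nat.card_congr ψ.toEquiv, Nat.card_pi]
    simp only [Nat.card_zmod]
  have hpow (x : I) : ∃ e, p x ^ f x = 2 ^ e := by
    obtain ⟨e, -, he⟩ := (Nat.dvd_prime_pow Nat.prime_two).mp
      (hcard ▸ Finset.dvd_prod_of_mem (fun x => p x ^ f x) (Finset.mem_univ x))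
    exact ⟨e, he⟩
  choose e he using hpow
  exact ⟨I, inferInstance, e,
    ⟨ψ.trans (AddEquiv.piCongrRight fun x => (ZMod.ringEquivCongr (he x)).toAddEquiv)⟩⟩

theorem IsCyclicallyHarmonious.of_card_eq_two_pow {A : Type*} [AddCommGroup A] {k : ℕ}
    (hA : Nat.card A = 2 ^ k) (hcyc : ¬ IsAddCyclic A) {z : A} (hz : 2 • z ≠ 0) :
    IsCyclicallyHarmonious A := by
  obtain ⟨I, _, e, ⟨ψ⟩⟩ := exists_addEquiv_pi_zmod_two_pow hA
  obtain ⟨i, hi⟩ : ∃ i, 2 ≤ e i := by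
    by_contra! hlt
    refine hz (ψ.injective (funext fun x => ?_))
    have htwo : ((2 : ℕ) : ZMod (2 ^ e x)) = 0 := by
      rw [ZMod.natCast_eq_zero_iff]
      exact (pow_dvd_pow 2 (Nat.le_of_lt_succ (hlt x))).trans (pow_one 2).dvd
    rw [map_nsmul, map_zero, Pi.smul_apply, nsmul_eq_mul, htwo, zero_mul, Pi.zero_apply]
  obtain ⟨j, hji, hj⟩ : ∃ j, j ≠ i ∧ 1 ≤ e j := by
    by_contra! hzero
    let φ : A →+ ZMod (2 ^ e i) := (Pi.evalAddMonoidHom _ i).comp ψ.toAddMonoidHom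
    refine hcyc (isAddCyclic_of_injective φ fun x y hxy => ψ.injective (funext fun j => ?_))
    by_cases hji : j = i
    · exact hji ▸ hxy
    · have : Subsingleton (ZMod (2 ^ e j)) := by
        rw [Nat.lt_one_iff.mp (hzero j hji), pow_zero]; infer_instance
      exact Subsingleton.elim _ _
  have he : IsAdmissible e := ⟨j, i, hji, hj, hi⟩
  exact he.isCyclicallyHarmonious_pi_zmod_two_pow.of_addEquiv ψ.symm

theorem card_ker_nsmulAddMonoidHom_le {A : Type*} [AddCommGroup A] {n : ℕ} (hn : 0 < n)
    [IsAddCyclic (nsmulAddMonoidHom (α := A) n).ker] :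
    Nat.card (nsmulAddMonoidHom (α := A) n).ker ≤ n := by
  rw [← IsAddCyclic.exponent_eq_card]
  exact Nat.le_of_dvd hn
    (AddMonoid.exponent_dvd_of_forall_nsmul_eq_zero fun x => Subtype.ext x.2)

theorem ker_nsmulAddMonoidHom_two_le_range {A : Type*} [AddCommGroup A] {m : ℕ} (hm : Odd m) :
    (nsmulAddMonoidHom (α := A) 2).ker ≤ (nsmulAddMonoidHom (α := A) m).range := by
  intro x hx
  obtain ⟨c, rfl⟩ := hm
  have hx2 : 2 • x = 0 := hx
  exact ⟨x, by rw [nsmulAddMonoidHom_apply, add_nsmul, mul_nsmul, hx2, nsmul_zero, zero_add,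
    one_nsmul]⟩

namespace IsCyclicallyHarmonious

variable {A : Type*} [AddCommGroup A] [Finite A]

theorem of_two_lt_card_ker_of_odd_card_range (h : 2 < Nat.card (nsmulAddMonoidHom (α := A) 2).ker)
    (hodd : Odd (Nat.card (nsmulAddMonoidHom (α := A) 2).range)) {z : A} (hz : 2 • z ≠ 0) :
    IsCyclicallyHarmonious A := by
  set δ := nsmulAddMonoidHom (α := A) 2
  have hone : 1 < Nat.card δ.range :=
    δ.range.one_lt_card_iff_ne_bot.mpr fun hbot => hz <|
      DFunLike.congr_fun (AddMonoidHom.range_eq_bot_iff.mp hbot) z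
  refine .of_exponent_two_ker δ.rangeRestrict_surjective (fun x hx => ?_)
    (by rwa [AddMonoidHom.ker_rangeRestrict]) (by grind) (.of_odd_card hodd)
  exact (two_nsmul x).symm.trans (congrArg Subtype.val hx)

theorem of_two_lt_card_ker (h : 2 < Nat.card (nsmulAddMonoidHom (α := A) 2).ker) {z : A}
    (hz : 2 • z ≠ 0) : IsCyclicallyHarmonious A := by
  obtain ⟨k, m, hm, hA⟩ := Nat.exists_eq_two_pow_mul_odd (Nat.card_pos (α := A)).ne'
  by_cases hdouble : ∀ x : A, m • 2 • x = 0
  · refine of_two_lt_card_ker_of_odd_card_range h (odd_card_of_nsmul_eq_zero hm ?_) hz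
    rintro ⟨_, x, rfl⟩
    exact Subtype.ext (hdouble x)
  obtain ⟨x, hx⟩ := not_forall.mp hdouble
  let μ := nsmulAddMonoidHom (α := A) m
  obtain ⟨l, hl⟩ : ∃ l, Nat.card μ.range = 2 ^ l := by
    refine exists_card_eq_two_pow_of_nsmul_eq_zero (k := k) ?_
    rintro ⟨_, y, rfl⟩
    exact Subtype.ext (show 2 ^ k • m • y = 0 by rw [← mul_nsmul', ← hA, card_nsmul_eq_zero'])
  have hker : Odd (Nat.card μ.rangeRestrict.ker) := by
    rw [AddMonoidHom.ker_rangeRestrict]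
    exact odd_card_of_nsmul_eq_zero hm fun y => Subtype.ext y.2
  have hcyc : ¬ IsAddCyclic μ.range := fun hμ =>
    have := AddSubgroup.isAddCyclic_of_le (ker_nsmulAddMonoidHom_two_le_range (A := A) hm)
    h.not_ge (card_ker_nsmulAddMonoidHom_le two_pos)
  refine .of_odd_card_ker μ.rangeRestrict_surjective hker
    (.of_card_eq_two_pow hl hcyc (z := μ.rangeRestrict x) fun h0 => hx ?_)
  rw [nsmul_left_comm]
  exact congrArg Subtype.val h0

end IsCyclicallyHarmonious

theorem SatisfiesCycleCondition.isCyclicallyHarmonious {n : ℕ} {A : Type*} [AddCommGroup A]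
    (hn : n ≠ 0) (hA : SatisfiesCycleCondition n A) : IsCyclicallyHarmonious A := by
  obtain ⟨hcard, hodd | ⟨-, s, hs, K, ⟨φ⟩⟩⟩ := hA
  · exact .of_odd_card (hcard ▸ hodd)
  have : Finite A := Nat.finite_of_card_ne_zero (hcard ▸ hn)
  let ψ : ZMod 2 × ZMod (2 * s) →+ A := K.subtype.comp φ.symm.toAddMonoidHom
  have hψ : Function.Injective ψ := K.subtype_injective.comp φ.symm.injective
  have hnatCast {c : ℕ} (hc : 0 < c) (hcs : c < 2 * s) : (c : ZMod (2 * s)) ≠ 0 := by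
    rw [Ne, ZMod.natCast_eq_zero_iff]
    exact Nat.not_dvd_of_pos_of_lt hc hcs
  have hx : 2 • ((1, 0) : ZMod 2 × ZMod (2 * s)) = 0 := by
    rw [Prod.smul_mk, smul_zero]
    rfl
  have hy : 2 • ((0, s) : ZMod 2 × ZMod (2 * s)) = 0 := by
    rw [Prod.smul_mk, smul_zero, nsmul_eq_mul, ← Nat.cast_mul, ZMod.natCast_self]
    rfl
  have hker : 2 < ((nsmulAddMonoidHom (α := A) 2).ker : Set A).ncard := by
    refine (Set.two_lt_ncard_iff (Set.toFinite _)).mpr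
      ⟨ψ 0, ψ (1, 0), ψ (0, s), (map_zero ψ).symm ▸ zero_mem _, ?_, ?_,
        hψ.ne ?_, hψ.ne ?_, hψ.ne ?_⟩
    · exact (map_nsmul ψ 2 _).symm.trans (hx ▸ map_zero ψ)
    · exact (map_nsmul ψ 2 _).symm.trans (hy ▸ map_zero ψ)
    · exact fun h => zero_ne_one (congrArg Prod.fst h)
    · exact fun h => hnatCast (c := s) (by omega) (by omega) (congrArg Prod.snd h).symm
    · exact fun h => one_ne_zero (congrArg Prod.fst h)
  refine .of_two_lt_card_ker hker (z := ψ (0, 1)) ?_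
  rw [← map_nsmul, Ne, map_eq_zero_iff ψ hψ]
  intro h
  refine hnatCast (c := 2) two_pos (by omega) ?_
  rw [← nsmul_one]
  exact congrArg Prod.snd h

/-! ### Labeling the web -/

theorem cycleGraph_adj_iff_eq_add_one {n : ℕ} [NeZero n] (hn : 1 < n) {u v : Fin n} :
    (SimpleGraph.cycleGraph n).Adj u v ↔ v = u + 1 ∨ u = v + 1 := by
  obtain ⟨k, rfl⟩ := Nat.exists_eq_add_of_le' hn
  rw [SimpleGraph.cycleGraph_adj, sub_eq_iff_eq_add', sub_eq_iff_eq_add', or_comm, add_comm u,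
    add_comm v, add_comm 1, add_comm 1]

section Web

variable {m n : ℕ}

/-- The neighbour of the vertex `some (j, i)` of the generalized closed web that is one step closer
to the apex `none`. -/
def webParent (j : Fin m) (i : Fin n) : Option (Fin m × Fin n) :=
  if j.val = 0 then none else some (⟨j.val - 1, (j.val.sub_le 1).trans_lt j.isLt⟩, i)

/-- The edges of the generalized closed web, each attributed to one of its ends `some (j, i)`: the
left copy of the index set enumerates the edges of the cycles, the right one the edges towards the
apex. -/
def webEdge [NeZero n] : (Fin m × Fin n) ⊕ (Fin m × Fin n) → Sym2 (Option (Fin m × Fin n))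
  | .inl (j, i) => s(some (j, i), some (j, i + 1))
  | .inr (j, i) => s(webParent j i, some (j, i))

theorem generalizedClosedWeb_adj_webParent (j : Fin m) (i : Fin n) :
    (generalizedClosedWeb m n).Adj (webParent j i) (some (j, i)) := by
  unfold webParent
  split_ifs with hj
  · exact hj
  · have hpred : j.val - 1 + 1 = j.val := Nat.sub_add_cancel (Nat.pos_of_ne_zero hj)
    exact SimpleGraph.boxProd_adj.mpr (.inl ⟨SimpleGraph.pathGraph_adj.mpr (.inl hpred), rfl⟩)

theorem webEdge_mem_edgeSet [NeZero n] (hn : 1 < n) (x : (Fin m × Fin n) ⊕ (Fin m × Fin n)) :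
    webEdge x ∈ (generalizedClosedWeb m n).edgeSet := by
  obtain ⟨j, i⟩ | ⟨j, i⟩ := x
  · exact SimpleGraph.boxProd_adj.mpr
      (.inr ⟨(cycleGraph_adj_iff_eq_add_one hn).mpr (.inl rfl), rfl⟩)
  · exact generalizedClosedWeb_adj_webParent j i

theorem mem_range_webEdge_of_adj [NeZero n] (hn : 1 < n) {x y : Option (Fin m × Fin n)}
    (h : (generalizedClosedWeb m n).Adj x y) : s(x, y) ∈ Set.range (webEdge (m := m) (n := n)) := by
  have hspoke {j : Fin m} {i : Fin n} (hj : j.val = 0) :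
      s(none, some (j, i)) ∈ Set.range (webEdge (m := m) (n := n)) :=
    ⟨.inr (j, i), by rw [webEdge, webParent, if_pos hj]⟩
  have hrung {j k : Fin m} {i : Fin n} (hjk : j.val + 1 = k.val) :
      s(some (j, i), some (k, i)) ∈ Set.range (webEdge (m := m) (n := n)) := by
    refine ⟨.inr (k, i), ?_⟩
    have hj : (⟨k.val - 1, (k.val.sub_le 1).trans_lt k.isLt⟩ : Fin m) = j := Fin.ext (by grind)
    rw [webEdge, webParent, if_neg (by omega), hj]
  obtain _ | ⟨j, i⟩ := x <;> obtain _ | ⟨k, l⟩ := y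
  · exact h.elim
  · exact hspoke h
  · exact Sym2.eq_swap ▸ hspoke h
  obtain ⟨hjk, rfl⟩ | ⟨hil, rfl⟩ := SimpleGraph.boxProd_adj.mp h
  · obtain hjk | hkj := SimpleGraph.pathGraph_adj.mp hjk
    · exact hrung hjk
    · exact Sym2.eq_swap ▸ hrung hkj
  · obtain (rfl : l = i + 1) | (rfl : i = l + 1) := (cycleGraph_adj_iff_eq_add_one hn).mp hil
    · exact ⟨.inl (j, i), rfl⟩
    · exact ⟨.inl (j, l), Sym2.eq_swap⟩

theorem range_webEdge [NeZero n] (hn : 1 < n) :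
    Set.range webEdge = (generalizedClosedWeb m n).edgeSet := by
  refine (Set.range_subset_iff.mpr (webEdge_mem_edgeSet hn)).antisymm fun e he => ?_
  induction e using Sym2.ind with
  | _ x y => exact mem_range_webEdge_of_adj hn he

variable {Γ : Type*} [AddCommGroup Γ] {H : AddSubgroup Γ} {g : Γ}

theorem modEq_addOrderOf_of_nsmul_add_eq {s t : ℕ} {x y : H} (h : s • g + x = t • g + y) :
    s ≡ t [MOD addOrderOf (g : Γ ⧸ H)] := by
  rw [← nsmul_eq_nsmul_iff_modEq, ← QuotientAddGroup.mk_nsmul, ← QuotientAddGroup.mk_nsmul,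
    ← QuotientAddGroup.mk_add_of_mem (s • g) x.2, h, QuotientAddGroup.mk_add_of_mem _ y.2]

/-- The vertex labeling of the generalized closed web that sends the apex to `0` and spreads the
cyclic arrangement `a` of `H`, rotated by `j`, over the coset `(j + 1) • g + H` on the `j`-th
cycle. -/
def webLabeling [NeZero n] (g : Γ) (a : Fin n ≃ H) : Option (Fin m × Fin n) → Γ
  | none => 0
  | some (j, i) => (j.val + 1) • g + a (i + j.val • 1)

theorem webLabeling_injective [NeZero n] (hg : addOrderOf (g : Γ ⧸ H) = 2 * m) (a : Fin n ≃ H) :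
    Function.Injective (webLabeling (m := m) g a) := by
  have hnone (j : Fin m) (i : Fin n) :
      0 ≠ webLabeling g a (some (j, i)) := fun h => by
    have hzero : 0 • g + ((0 : H) : Γ) = (j.val + 1) • g + a (i + j.val • 1) := by
      rwa [zero_nsmul, ZeroMemClass.coe_zero, zero_add]
    have := (modEq_addOrderOf_of_nsmul_add_eq hzero).eq_of_lt_of_lt (by grind) (by grind)
    omega
  rintro (_ | ⟨j, i⟩) (_ | ⟨k, l⟩) h
  · rfl
  · exact (hnone _ _ h).elim
  · exact (hnone _ _ h.symm).elim
  · have hmod := modEq_addOrderOf_of_nsmul_add_eq h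
    obtain rfl : j = k :=
      Fin.ext (Nat.succ_injective (hmod.eq_of_lt_of_lt (by grind) (by grind)))
    have hil : i + j.val • 1 = l + j.val • 1 := a.injective (Subtype.ext (add_left_cancel h))
    rw [add_right_cancel hil]

theorem edgeLabel_webLabeling_inl [NeZero n] (a : Fin n ≃ H) (j : Fin m) (i : Fin n) :
    edgeLabel (webLabeling g a) (webEdge (.inl (j, i))) =
      (2 * j.val + 1 + 1) • g + (a (i + j.val • 1) + a (i + j.val • 1 + 1) : H) := by
  rw [add_right_comm i]
  change (j.val + 1) • g + _ + ((j.val + 1) • g + _) = _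
  rw [AddSubgroup.coe_add]
  module

theorem exists_edgeLabel_webLabeling_inr [NeZero n] {a : Fin n ≃ H}
    (ha : Function.Injective fun k => a k + a (k + 1)) (j : Fin m) :
    ∃ d : Fin n → H, Function.Injective d ∧ ∀ i,
      edgeLabel (webLabeling g a) (webEdge (.inr (j, i))) = (2 * j.val + 1) • g + d i := by
  obtain ⟨_ | j, hj⟩ := j
  · refine ⟨a, a.injective, fun i => ?_⟩
    change 0 + (1 • g + (a (i + 0 • 1) : Γ)) = _
    rw [zero_nsmul, add_zero, zero_add]
    rfl
  · refine ⟨fun i => a (i + j • 1) + a (i + j • 1 + 1), ha.comp (add_left_injective _),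
      fun i => ?_⟩
    change (j + 1) • g + (a (i + j • 1) : Γ) + ((j + 1 + 1) • g + a (i + (j + 1) • 1)) =
      (2 * (j + 1) + 1) • g + (a (i + j • 1) + a (i + j • 1 + 1) : H)
    rw [add_assoc i, ← succ_nsmul, AddSubgroup.coe_add]
    module

theorem edgeLabel_webLabeling_comp_webEdge_injective [NeZero n]
    (hg : addOrderOf (g : Γ ⧸ H) = 2 * m) {a : Fin n ≃ H}
    (ha : Function.Injective fun k => a k + a (k + 1)) :
    Function.Injective (edgeLabel (webLabeling (m := m) g a) ∘ webEdge) := by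
  choose d hd hlabel using exists_edgeLabel_webLabeling_inr (m := m) (g := g) ha
  have hcoset {s t : ℕ} {x y : H} (hs : s < 2 * m) (ht : t < 2 * m)
      (h : (s + 1) • g + x = (t + 1) • g + y) : s = t :=
    (Nat.ModEq.add_right_cancel' 1 (hg ▸ modEq_addOrderOf_of_nsmul_add_eq h)).eq_of_lt_of_lt hs ht
  rintro (⟨j, i⟩ | ⟨j, i⟩) (⟨k, l⟩ | ⟨k, l⟩) h <;>
    simp only [Function.comp_apply, edgeLabel_webLabeling_inl, hlabel] at h <;>
    have hjk := hcoset (by grind) (by grind) h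
  · obtain rfl : j = k := Fin.ext (by omega)
    have := add_right_cancel (ha (Subtype.ext (add_left_cancel h)))
    rw [this]
  · omega
  · omega
  · obtain rfl : j = k := Fin.ext (by omega)
    have := hd j (Subtype.ext (add_left_cancel h))
    rw [this]

theorem isHarmoniousLabeling_webLabeling [NeZero n] (hm : 0 < m) (hn : 1 < n)
    (hg : addOrderOf (g : Γ ⧸ H) = 2 * m) (hΓ : Nat.card Γ = 2 * m * n) {a : Fin n ≃ H}
    (ha : Function.Injective fun k => a k + a (k + 1)) :
    IsHarmoniousLabeling (generalizedClosedWeb m n) (webLabeling g a) := by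
  have : Finite Γ := Nat.finite_of_card_ne_zero (by rw [hΓ]; positivity)
  have hinj := edgeLabel_webLabeling_comp_webEdge_injective hg ha
  have hbij := hinj.bijective_of_nat_card_le (by simp [hΓ]; linarith)
  rw [IsHarmoniousLabeling, ← range_webEdge hn]
  refine ⟨webLabeling_injective hg a, Set.mapsTo_univ _ _, hinj.injOn_range, ?_⟩
  rw [Set.SurjOn, ← Set.range_comp, hbij.surjective.range_eq]

end Web

theorem IsCyclicallyHarmonious.isHarmonious_generalizedClosedWeb {Γ : Type*} [AddCommGroup Γ]
    {m n : ℕ} (hm : 0 < m) (hn : 1 < n) (hΓ : Nat.card Γ = 2 * m * n) {H : AddSubgroup Γ}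
    [IsAddCyclic (Γ ⧸ H)] (hcard : Nat.card H = n) (hH : IsCyclicallyHarmonious H) :
    IsHarmonious Γ (generalizedClosedWeb m n) := by
  obtain ⟨n', _, a, ha⟩ := hH
  obtain rfl : n' = n := by rw [← hcard, ← Nat.card_congr a, Nat.card_fin]
  obtain ⟨x, hx⟩ := IsAddCyclic.exists_generator (α := Γ ⧸ H)
  obtain ⟨g, rfl⟩ := QuotientAddGroup.mk_surjective x
  refine ⟨webLabeling g a, isHarmoniousLabeling_webLabeling hm hn ?_ hΓ ha⟩
  have hquot := H.card_eq_card_quotient_mul_card_addSubgroup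
  rw [hΓ, hcard] at hquot
  rw [addOrderOf_eq_card_of_forall_mem_zmultiples hx]
  exact (Nat.eq_of_mul_eq_mul_right (by omega) hquot).symm

theorem mainTheorem4_general {Γ : Type*} [AddCommGroup Γ] (m n : ℕ) (hn : 3 ≤ n) (hm : 0 < m)
    (hΓ : Nat.card Γ = 2 * m * n) (H : AddSubgroup Γ) (hH : SatisfiesCycleCondition n H)
    (hcyc : IsAddCyclic (Γ ⧸ H)) :
    IsHarmonious Γ (generalizedClosedWeb m n) :=
  (hH.isCyclicallyHarmonious (by omega)).isHarmonious_generalizedClosedWeb hm (by omega) hΓ hH.1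

theorem mainTheorem4 {Γ : Type*} [AddCommGroup Γ] (m n : ℕ) (hn : 3 ≤ n) (hm : 2 ≤ m)
    (hΓ : Nat.card Γ = 2 * m * n) (H : AddSubgroup Γ) (hH : SatisfiesCycleCondition n H)
    (hcyc : IsAddCyclic (Γ ⧸ H)) :
    IsHarmonious Γ (generalizedClosedWeb m n) := by
  exact mainTheorem4_general m n hn (by omega) hΓ H hH hcyc
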